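/- A bounded involution lattice is a bounded lattice $(L,\vee,\wedge,0,1)$ with an order-reversing operation $'$ satisfying $a''=a$ for all $a\in L$; it is a pseudo-Kleene algebra (and $'$ is called its Kleene complement) if moreover $a\wedge a'\le b\vee b'$ for all $a,b\in L$. A BZ-lattice is a pseudo-Kleene algebra with an order-reversing operation $^{\sim}$ such that $a\wedge a^{\sim}=0$ and $a\le a^{\sim\sim}=a^{\sim\prime}$ for all $a$. An antiortholattice is a BZ-lattice $L$ such that: for all $a,b\in L$, if $a\le b$ and $a'\wedge b=0$, then $a=b$; $(a\wedge a')^{\sim}=a^{\sim}\vee a'^{\sim}$ for all $a\in L$; and $0,1$ are the only elements $a\in L$ for which $a'$ is a lattice complement of $a$ (that is, $a\wedge a'=0$ and $a\vee a'=1$). For a BZ-lattice $A$, let $\mathrm{Filt}(A)$ and $\mathrm{Id}(A)$ be the sets of all (nonempty, not necessarily proper) lattice filters and ideals of $A$, let $\mathrm{Con}_{\mathbb{BZ}}(A)$ be the set of the equivalence relations on $A$ that are compatible with $\vee,\wedge,{}',{}^{\sim}$, let $\mathrm{Con}_{01}(A)$ be the set of the equivalence relations on $A$ that are compatible with $\vee,\wedge$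 and for which the classes of $0$ and of $1$ are the singletons $\{0\}$ and $\{1\}$, and let $\nabla_A=A\times A$. **Corollary.** Let $\nu$ be an infinite cardinal number, let $\kappa$ be a cardinal number with $2\le\kappa\le\nu$ or $\kappa=2^{\nu}$, and let $\mu\in\{\nu,2^{\nu}\}$. Then there exists an antiortholattice $A$ with $|A|=\nu$, $|\mathrm{Filt}(A)|=|\mathrm{Id}(A)|=\mu$ and $|\mathrm{Con}_{\mathbb{BZ}}(A)|=\kappa$ such that, if $\kappa\le\nu$, then $\mathrm{Con}_{\mathbb{BZ}}(A)=\mathrm{Con}_{01}(A)\cup\{\nabla_A\}$. -/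

import Mathlib

universe u

open Cardinal

/-- A bounded involution lattice: a bounded lattice with an order-reversing operation `invol`
(written `a′` in the comments) satisfying `a′′ = a`. -/
class BoundedInvolutionLattice (L : Type u) extends Lattice L, BoundedOrder L where
  invol : L → L
  invol_antitone : ∀ a b : L, a ≤ b → invol b ≤ invol a
  invol_invol : ∀ a : L, invol (invol a) = a

/-- A pseudo-Kleene algebra: a bounded involution lattice with `a ∧ a′ ≤ b ∨ b′` for all `a, b`.
Its involution is called the Kleene complement. -/
class PseudoKleeneAlgebra (L : Type u) extends BoundedInvolutionLattice L where
  kleene : ∀ a b : L, a ⊓ invol a ≤ b ⊔ invol b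

/-- A Brouwer-Zadeh lattice: a pseudo-Kleene algebra with an order-reversing operation `brouwer`
(the Brouwer complement `a~`) such that `a ∧ a~ = 0` and `a ≤ a~~ = a~′`. -/
class BZLattice (L : Type u) extends PseudoKleeneAlgebra L where
  brouwer : L → L
  brouwer_antitone : ∀ a b : L, a ≤ b → brouwer b ≤ brouwer a
  inf_brouwer : ∀ a : L, a ⊓ brouwer a = ⊥
  le_brouwer_brouwer : ∀ a : L, a ≤ brouwer (brouwer a)
  brouwer_brouwer : ∀ a : L, brouwer (brouwer a) = invol (brouwer a)

/-- A PBZ*-lattice: a paraorthomodular BZ-lattice with `(a ∧ a′)~ = a~ ∨ a′~` for all `a`. -/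
class PBZStarLattice (L : Type u) extends BZLattice L where
  paraorthomodular : ∀ a b : L, a ≤ b → invol a ⊓ b = ⊥ → a = b
  brouwer_inf_invol : ∀ a : L, brouwer (a ⊓ invol a) = brouwer a ⊔ brouwer (invol a)

/-- An antiortholattice: a PBZ*-lattice in which `0` and `1` are the only elements whose Kleene
complement is a complement in the bounded lattice. -/
class Antiortholattice (L : Type u) extends PBZStarLattice L where
  isCompl_invol_iff : ∀ a : L, IsCompl a (invol a) ↔ a = ⊥ ∨ a = ⊤

/-- `Con(L)`: the set of the equivalence relations on `L` that are lattice congruences. -/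
def latticeCongruences (L : Type u) [Lattice L] : Set (Setoid L) :=
  Set.range (LatticeCon.toSetoid : LatticeCon L → Setoid L)

/-- `Con₀₁(L)`: the lattice congruences of a bounded lattice for which the classes of `0` and of
`1` are singletons. -/
def latticeCongruences01 (L : Type u) [Lattice L] [BoundedOrder L] : Set (Setoid L) :=
  {θ | θ ∈ latticeCongruences L ∧ {x | θ x ⊥} = {⊥} ∧ {x | θ x ⊤} = {⊤}}

/-- `Con_BZ(L)`: the congruences of a BZ-lattice, that is, the equivalence relations compatible
with the lattice operations, the Kleene complement and the Brouwer complement. -/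
def bzCongruences (L : Type u) [BZLattice L] : Set (Setoid L) :=
  {θ | θ ∈ latticeCongruences L ∧
    (∀ x y : L, θ x y →
      θ (BoundedInvolutionLattice.invol x) (BoundedInvolutionLattice.invol y)) ∧
    (∀ x y : L, θ x y → θ (BZLattice.brouwer x) (BZLattice.brouwer y))}

/-! The algebra is the ordinal sum of `L`, `K` and the dual of `L`, where `L` has a bottom and `K`
carries a Kleene involution. The involution swaps the copies of `L`; the Brouwer complement sends 0
to 1 and all else to 0. A BZ-congruence identifying some x ≠ 0 with 0 therefore identifies 1 with 0,
so every BZ-congruence but the total one isolates 0 and 1.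

For κ ≤ ν, `L` consists of the intervals, or of the finite subsets, of a well-order of size ν.
Either lattice separates elements by disjointness and has no top, so a congruence isolating 0 and 1
identifies distinct elements only inside `K` (`exists_eq_con`). Intervals give ν ideals and finite
sets give 2^ν. `K` is a chain of nested copies of M₃ indexed by a well-order `I`. As M₃ is simple,
collapsing any two elements collapses everything up to the higher of their levels. Congruences of
`K` are thus lower sets of `I` (`exists_eq_levelCon`), |I| + 1 in number, and all respect the
involution. With the total congruence this makes |I| + 2 = κ, while `K` has at most ν ideals.

For κ = 2^ν, `K` is a point and `L` is a well-order, or a lattice of finite sets, with a new bottom.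
Intersecting with each subset of the index set gives 2^ν congruences (`mk_bzCongruences_withBot`).
-/

/-- A lattice, not necessarily bounded, with an antitone involution satisfying Kleene's
inequality. -/
class KleeneLattice (K : Type u) extends Lattice K where
  neg : K → K
  neg_antitone : ∀ a b : K, a ≤ b → neg b ≤ neg a
  neg_neg : ∀ a : K, neg (neg a) = a
  neg_kleene : ∀ a b : K, a ⊓ neg a ≤ b ⊔ neg b

/-! ### The nested chain of M₃'s as a Kleene lattice. -/

/-- The union of a chain of nested copies of `M₃`: every level `i` is a copy of `Bool × Bool`, and
the `core` and all levels below `i` lie strictly between the bottom and the top of level `i`. The two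
other elements of level `i` are complements, in this interval, of each other and of everything
strictly inside. -/
inductive NestedM3 (I : Type u) : Type u
  | core : NestedM3 I
  | node (i : I) (t : Bool × Bool) : NestedM3 I

namespace NestedM3

variable {I : Type u}

def neg : NestedM3 I → NestedM3 I
  | core => core
  | node i t => node i tᶜ

theorem neg_neg (a : NestedM3 I) : neg (neg a) = a := by
  cases a <;> simp [neg]

variable [LinearOrder I]

instance : PartialOrder (NestedM3 I) where
  le a b := match a, b with
    | core, core => True
    | core, node _ t => t = ⊤
    | node _ s, core => s = ⊥
    | node i s, node j t => (i < j ∧ t = ⊤) ∨ (j < i ∧ s = ⊥) ∨ (i = j ∧ s ≤ t)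
  le_refl a := by cases a <;> simp
  le_trans a b c := by
    have h1 : ∀ s : Bool × Bool, s ≤ ⊤ := fun _ => le_top
    have h2 : ∀ s : Bool × Bool, ⊥ ≤ s := fun _ => bot_le
    have h3 : ∀ s : Bool × Bool, ⊤ ≤ s → s = ⊤ := fun _ => top_le_iff.1
    have h4 : ∀ s : Bool × Bool, s ≤ ⊥ → s = ⊥ := fun _ => le_bot_iff.1
    have h5 : (⊤ : Bool × Bool) ≠ ⊥ := by decide
    rcases a with _ | ⟨i, r⟩ <;> rcases b with _ | ⟨j, s⟩ <;> rcases c with _ | ⟨k, t⟩ <;>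
      grind
  le_antisymm a b := by
    have h5 : (⊤ : Bool × Bool) ≠ ⊥ := by decide
    rcases a with _ | ⟨i, r⟩ <;> rcases b with _ | ⟨j, s⟩ <;> grind

theorem core_le_node {j : I} {t : Bool × Bool} : core ≤ node j t ↔ t = ⊤ := Iff.rfl

theorem node_le_core {i : I} {s : Bool × Bool} : node i s ≤ core ↔ s = ⊥ := Iff.rfl

theorem node_le_node {i j : I} {s t : Bool × Bool} : node i s ≤ node j t ↔
    (i < j ∧ t = ⊤) ∨ (j < i ∧ s = ⊥) ∨ (i = j ∧ s ≤ t) := Iff.rfl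

theorem neg_antitone (a b : NestedM3 I) (h : a ≤ b) : neg b ≤ neg a := by
  rcases a with _ | ⟨i, s⟩ <;> rcases b with _ | ⟨j, t⟩ <;>
    simp only [neg, core_le_node, node_le_core, node_le_node, compl_eq_bot, compl_eq_top,
      compl_le_compl_iff_le, le_refl] at * <;> grind

def sup : NestedM3 I → NestedM3 I → NestedM3 I
  | core, core => core
  | core, node j t => if t = ⊥ then core else node j ⊤
  | node i s, core => if s = ⊥ then core else node i ⊤
  | node i s, node j t =>
    if i < j then (if t = ⊥ then node i s else node j ⊤)
    else if j < i then (if s = ⊥ then node j t else node i ⊤)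
    else node i (s ⊔ t)

theorem le_sup_left' (a b : NestedM3 I) : a ≤ sup a b := by
  have h1 : ∀ s : Bool × Bool, s ≤ ⊤ := fun _ => le_top
  rcases a with _ | ⟨i, s⟩ <;> rcases b with _ | ⟨j, t⟩ <;> simp only [sup] <;> (try split_ifs) <;>
    simp only [core_le_node, node_le_core, node_le_node, le_refl, le_sup_left] <;> grind

theorem le_sup_right' (a b : NestedM3 I) : b ≤ sup a b := by
  have h1 : ∀ s : Bool × Bool, s ≤ ⊤ := fun _ => le_top
  rcases a with _ | ⟨i, s⟩ <;> rcases b with _ | ⟨j, t⟩ <;> simp only [sup] <;> (try split_ifs) <;>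
    simp only [core_le_node, node_le_core, node_le_node, le_refl, le_sup_right] <;> grind

theorem sup_le' (a b c : NestedM3 I) (hac : a ≤ c) (hbc : b ≤ c) : sup a b ≤ c := by
  have h1 : ∀ s : Bool × Bool, s ≤ ⊤ := fun _ => le_top
  have h3 : ∀ s : Bool × Bool, ⊤ ≤ s → s = ⊤ := fun _ => top_le_iff.1
  have h4 : ∀ s : Bool × Bool, s ≤ ⊥ → s = ⊥ := fun _ => le_bot_iff.1
  have h5 : (⊤ : Bool × Bool) ≠ ⊥ := by decide
  rcases a with _ | ⟨i, s⟩ <;> rcases b with _ | ⟨j, t⟩ <;> rcases c with _ | ⟨k, r⟩ <;>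
    simp only [sup] <;> (try split_ifs) <;>
    simp only [core_le_node, node_le_core, node_le_node, le_refl, sup_le_iff, sup_eq_bot_iff] at * <;>
    grind

instance : KleeneLattice (NestedM3 I) where
  sup := sup
  le_sup_left := le_sup_left'
  le_sup_right := le_sup_right'
  sup_le := sup_le'
  inf a b := neg (sup (neg a) (neg b))
  inf_le_left a b := by
    simpa [neg_neg] using neg_antitone _ _ (le_sup_left' (neg a) (neg b))
  inf_le_right a b := by
    simpa [neg_neg] using neg_antitone _ _ (le_sup_right' (neg a) (neg b))
  le_inf a b c hab hac := by
    simpa [neg_neg] using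
      neg_antitone _ _ (sup_le' _ _ _ (neg_antitone _ _ hab) (neg_antitone _ _ hac))
  neg := neg
  neg_antitone := neg_antitone
  neg_neg := neg_neg
  neg_kleene a b := by
    -- Meets a ∧ a′ are level bottoms (or the core) and joins b ∨ b′ are level tops (or the core);
    -- every level bottom lies below every level top.
    have h : ∀ i s, neg (sup (neg (node i s)) (neg (neg (node i s)))) = (node i ⊥ : NestedM3 I) := by
      intro i s; simp [neg, sup]
    have h' : ∀ i s, sup (node i s) (neg (node i s)) = (node i ⊤ : NestedM3 I) := by
      intro i s; simp [neg, sup]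
    change neg (sup (neg a) (neg (neg a))) ≤ sup b (neg b)
    rcases a with _ | ⟨i, s⟩ <;> rcases b with _ | ⟨j, t⟩
    · exact le_refl core
    · rw [h']; rfl
    · rw [h]; rfl
    · rw [h, h', node_le_node]
      rcases lt_trichotomy i j with h | h | h <;> simp [h]

theorem sup_def (a b : NestedM3 I) : a ⊔ b = sup a b := rfl

theorem inf_def (a b : NestedM3 I) : a ⊓ b = neg (sup (neg a) (neg b)) := rfl

end NestedM3

/-! ### Congruences and ideals of the nested chain. -/

namespace NestedM3

variable {I : Type u} [LinearOrder I]

/-- The elements whose level belongs to `D`, together with the core. -/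
def LevelMem (D : LowerSet I) : NestedM3 I → Prop
  | core => True
  | node i _ => i ∈ D

theorem levelMem_neg {D : LowerSet I} {a : NestedM3 I} : LevelMem D (neg a) ↔ LevelMem D a := by
  cases a <;> rfl

theorem LevelMem.sup {D : LowerSet I} {a b : NestedM3 I} (ha : LevelMem D a) (hb : LevelMem D b) :
    LevelMem D (a ⊔ b) := by
  rw [sup_def]
  rcases a with _ | ⟨i, s⟩ <;> rcases b with _ | ⟨j, t⟩ <;> simp only [NestedM3.sup] <;>
    (try split_ifs) <;> assumption

theorem LevelMem.sup_node {D : LowerSet I} {a : NestedM3 I} (ha : LevelMem D a) {k : I}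
    (hk : k ∉ D) (t : Bool × Bool) : a ⊔ node k t = if t = ⊥ then a else node k ⊤ := by
  rw [sup_def]
  rcases a with _ | ⟨i, s⟩
  · rfl
  · have : i < k := lt_of_not_ge fun h => hk (D.lower h ha)
    simp [NestedM3.sup, this]

/-- An element above the levels of `D` does not see which element of `D` it is joined with: the join
is that element itself or the top of the higher level. -/
theorem eq_or_levelMem_sup {D : LowerSet I} {a b : NestedM3 I}
    (h : a = b ∨ LevelMem D a ∧ LevelMem D b) (w : NestedM3 I) :
    a ⊔ w = b ⊔ w ∨ LevelMem D (a ⊔ w) ∧ LevelMem D (b ⊔ w) := by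
  rcases h with rfl | ⟨ha, hb⟩
  · exact Or.inl rfl
  · by_cases hw : LevelMem D w
    · exact Or.inr ⟨ha.sup hw, hb.sup hw⟩
    · rcases w with _ | ⟨k, t⟩
      · exact absurd trivial hw
      · rw [ha.sup_node hw, hb.sup_node hw]
        split_ifs
        · exact Or.inr ⟨ha, hb⟩
        · exact Or.inl rfl

theorem neg_inf (a b : NestedM3 I) : neg (a ⊓ b) = neg a ⊔ neg b := by
  rw [inf_def, neg_neg, sup_def]

def levelSetoid (D : LowerSet I) : Setoid (NestedM3 I) where
  r a b := a = b ∨ LevelMem D a ∧ LevelMem D b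
  iseqv := ⟨fun _ => Or.inl rfl, fun h => h.imp Eq.symm And.symm, by
    rintro a b c (rfl | h) (rfl | h')
    exacts [Or.inl rfl, Or.inr h', Or.inr h, Or.inr ⟨h.1, h'.2⟩]⟩

theorem levelSetoid_neg {D : LowerSet I} {a b : NestedM3 I} :
    levelSetoid D (neg a) (neg b) ↔ levelSetoid D a b := by
  change (neg a = neg b ∨ _) ↔ (a = b ∨ _)
  rw [levelMem_neg, levelMem_neg, (Function.LeftInverse.injective neg_neg).eq_iff]

theorem levelSetoid_sup {D : LowerSet I} {a b c d : NestedM3 I} (h : levelSetoid D a b)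
    (h' : levelSetoid D c d) : levelSetoid D (a ⊔ c) (b ⊔ d) := by
  refine (levelSetoid D).trans (eq_or_levelMem_sup h c) ?_
  rw [sup_comm b, sup_comm b]
  exact eq_or_levelMem_sup h' b

/-- The congruence that collapses all levels in `D` and the core to one class. -/
def levelCon (D : LowerSet I) : LatticeCon (NestedM3 I) where
  toSetoid := levelSetoid D
  sup := levelSetoid_sup
  inf {a b c d} h h' := by
    refine levelSetoid_neg.1 ?_
    rw [neg_inf, neg_inf]
    exact levelSetoid_sup (levelSetoid_neg.2 h) (levelSetoid_neg.2 h')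

theorem levelCon_injective :
    Function.Injective fun D : LowerSet I => (levelCon D).toSetoid := by
  intro D E h
  have key : ∀ (D : LowerSet I) (i : I), levelSetoid D (node i ⊥) (node i ⊤) ↔ i ∈ D := by
    intro D i
    change (_ ∨ i ∈ D ∧ i ∈ D) ↔ _
    have : (⊥ : Bool × Bool) ≠ ⊤ := by decide
    simp [this]
  ext i
  change i ∈ D ↔ i ∈ E
  rw [← key D, ← key E]
  exact iff_of_eq (congrArg (fun θ : Setoid (NestedM3 I) => θ (node i ⊥) (node i ⊤)) h)

/-- Every interior element of the interval of level `j` is an atom of a copy of M₃ spanning it. The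
other two atoms are the middle elements of level `j`, or one of them and the core. -/
theorem exists_complements {j : I} {v : NestedM3 I} (hv : v ∈ Set.Icc (node j ⊥) (node j ⊤))
    (h0 : v ≠ node j ⊥) (h1 : v ≠ node j ⊤) :
    ∃ p q, v ⊔ p = node j ⊤ ∧ v ⊔ q = node j ⊤ ∧ p ⊓ q = node j ⊥ ∧ v ⊓ p = node j ⊥ ∧
      p ≠ node j ⊥ := by
  have inner : ∀ {v : NestedM3 I}, (v = core ∨ ∃ i t, i < j ∧ v = node i t) →
      v ⊔ node j (true, false) = node j ⊤ ∧ v ⊔ node j (false, true) = node j ⊤ ∧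
      v ⊓ node j (true, false) = node j ⊥ ∧ v ⊓ node j (false, true) = node j ⊥ := by
    rintro v (rfl | ⟨i, t, hij, rfl⟩)
    · simp [sup_def, inf_def, NestedM3.sup, NestedM3.neg, Prod.ext_iff]
    · simp [sup_def, inf_def, NestedM3.sup, NestedM3.neg, Prod.ext_iff, hij]
  have hc := inner (v := core) (Or.inl rfl)
  have hxy : node j (true, false) ⊔ node j (false, true) = node j ⊤ := by
    simp [sup_def, NestedM3.sup]; rfl
  have h2 : node j (true, false) ⊓ node j (false, true) = node j ⊥ := by
    simp [inf_def, NestedM3.sup, NestedM3.neg]; rfl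
  have h3 : node j (true, false) ≠ node j ⊥ := by simp [Prod.ext_iff]
  have h4 : node j (false, true) ≠ node j ⊥ := by simp [Prod.ext_iff]
  by_cases hi : v = core ∨ ∃ i t, i < j ∧ v = node i t
  · obtain ⟨a, b, c, d⟩ := inner hi
    exact ⟨_, _, a, b, h2, c, h3⟩
  · rcases v with _ | ⟨i, t⟩
    · exact absurd (Or.inl rfl) hi
    · have hij : i = j := by
        obtain ⟨ha, hb⟩ := hv
        rw [node_le_node] at ha hb
        rcases lt_trichotomy i j with h | h | h
        · exact absurd (Or.inr ⟨i, t, h, rfl⟩) hi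
        · exact h
        · have : (⊤ : Bool × Bool) ≠ ⊥ := by decide
          grind
      subst hij
      obtain ⟨a, b, c, d⟩ := hc
      rcases t with ⟨_ | _, _ | _⟩
      · exact absurd rfl h0
      · exact ⟨_, core, by rw [sup_comm, hxy], by rw [sup_comm, b], by rw [inf_comm, c],
          by rw [inf_comm, h2], h3⟩
      · exact ⟨_, core, hxy, by rw [sup_comm, a], by rw [inf_comm, d], h2, h4⟩
      · contradiction

/-- Reduces a collapsed pair to one that involves an endpoint of the interval. -/
theorem inf_eq_or_sup_eq {j : I} (t : Bool × Bool) {v : NestedM3 I}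
    (hv : v ∈ Set.Icc (node j ⊥) (node j ⊤)) (h : v ≠ node j t) :
    node j t ⊓ v = node j ⊥ ∨ node j t ⊔ v = node j ⊤ := by
  have h' : ∀ s t : Bool × Bool, s ≠ t → tᶜ ⊔ sᶜ = ⊤ ∨ t ⊔ s = ⊤ := by decide
  by_cases ht : t = ⊥
  · subst ht
    exact Or.inl (inf_eq_left.2 hv.1)
  rcases v with _ | ⟨i, s⟩
  · simp [sup_def, NestedM3.sup, ht]
  · obtain ⟨ha, hb⟩ := hv
    rw [node_le_node] at ha hb
    have h5 : (⊤ : Bool × Bool) ≠ ⊥ := by decide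
    rcases lt_trichotomy i j with hij | hij | hij
    · simp [sup_def, NestedM3.sup, ht, hij, not_lt_of_gt hij]
    · subst hij
      have := h' s t (by rintro rfl; exact h rfl)
      rcases this with h | h <;> simp [inf_def, sup_def, NestedM3.sup, NestedM3.neg, h]
    · grind

variable (c : LatticeCon (NestedM3 I))

/-- Simplicity of M₃: joining with `p` identifies `p` with the top, meeting with `q` then identifies
the bottom with `q`, and joining `v` with `q` gives the top. -/
theorem con_bot_top_of_bot {j : I} {v : NestedM3 I} (hv : v ∈ Set.Icc (node j ⊥) (node j ⊤))
    (h0 : v ≠ node j ⊥) (h : c.r (node j ⊥) v) : c.r (node j ⊥) (node j ⊤) := by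
  by_cases h1 : v = node j ⊤
  · rwa [h1] at h
  obtain ⟨p, q, hp, hq, hpq, hvp, -⟩ := exists_complements hv h0 h1
  have hp0 : node j ⊥ ⊔ p = p := sup_eq_right.2 (hvp ▸ inf_le_right)
  have hq0 : node j ⊥ ⊔ q = q := sup_eq_right.2 (hpq ▸ inf_le_right)
  have hq1 : q ≤ node j ⊤ := hq ▸ le_sup_right
  have e1 : c.r p (node j ⊤) := by simpa [hp0, hp] using c.sup h (c.refl p)
  have e2 : c.r (node j ⊥) q := by
    simpa [hpq, inf_eq_right.2 hq1] using c.inf e1 (c.refl q)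
  simpa [hq] using c.sup h e2

theorem con_bot_top_of_top {j : I} {v : NestedM3 I} (hv : v ∈ Set.Icc (node j ⊥) (node j ⊤))
    (h1 : v ≠ node j ⊤) (h : c.r v (node j ⊤)) : c.r (node j ⊥) (node j ⊤) := by
  by_cases h0 : v = node j ⊥
  · rwa [h0] at h
  obtain ⟨p, q, hp, hq, hpq, hvp, hp0⟩ := exists_complements hv h0 h1
  have hp1 : p ≤ node j ⊤ := hp ▸ le_sup_right
  refine con_bot_top_of_bot c ⟨hvp ▸ inf_le_right, hp1⟩ hp0 ?_
  simpa [hvp, inf_eq_right.2 hp1] using c.inf h (c.refl p)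

theorem con_bot_top {j : I} {t : Bool × Bool} {v : NestedM3 I}
    (hv : v ∈ Set.Icc (node j ⊥) (node j ⊤)) (hne : v ≠ node j t) (h : c.r (node j t) v) :
    c.r (node j ⊥) (node j ⊤) := by
  have ht : node j t ∈ Set.Icc (node j ⊥) (node j ⊤) := by
    constructor <;> simp [node_le_node]
  rcases inf_eq_or_sup_eq t hv hne with e | e
  · by_cases h0 : node j t = node j ⊥
    · exact con_bot_top_of_bot c hv (h0 ▸ hne) (h0 ▸ h)
    · exact con_bot_top_of_bot c ht h0 (by simpa [e] using c.inf (c.refl (node j t)) (c.symm h))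
  · by_cases h0 : node j t = node j ⊤
    · exact con_bot_top_of_top c hv (h0 ▸ hne) (c.symm (h0 ▸ h))
    · exact con_bot_top_of_top c ht h0 (by simpa [e] using c.sup (c.refl (node j t)) h)

theorem con_of_bot_top {j : I} (h : c.r (node j ⊥) (node j ⊤)) {v : NestedM3 I}
    (hv : v ∈ Set.Icc (node j ⊥) (node j ⊤)) : c.r (node j ⊥) v := by
  simpa [inf_eq_left.2 hv.1, inf_eq_right.2 hv.2] using c.inf h (c.refl v)

theorem mem_Icc_core (j : I) : core ∈ Set.Icc (node j ⊥) (node j ⊤) := ⟨rfl, rfl⟩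

theorem node_mem_Icc {i j : I} (h : i ≤ j) (t : Bool × Bool) :
    node i t ∈ Set.Icc (node j ⊥) (node j ⊤) := by
  rcases h.lt_or_eq with h | rfl
  · simp [node_le_node, h]
  · simp [node_le_node]

theorem exists_eq_levelCon : ∃ D : LowerSet I, c.toSetoid = (levelCon D).toSetoid := by
  -- The levels whose interval is collapsed form a lower set because the intervals are nested.
  let D : LowerSet I := ⟨{j | c.r (node j ⊥) (node j ⊤)}, fun j i hij h =>
    c.trans (c.symm (con_of_bot_top c h (node_mem_Icc hij ⊥)))
      (con_of_bot_top c h (node_mem_Icc hij ⊤))⟩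
  have key : ∀ {i j : I} {s t}, i ≤ j → c.r (node i s) (node j t) → node i s ≠ node j t →
      LevelMem D (node i s) ∧ LevelMem D (node j t) := by
    intro i j s t hij h hne
    have hj : j ∈ D := con_bot_top c (node_mem_Icc hij s) hne (c.symm h)
    exact ⟨D.lower hij hj, hj⟩
  have key' : ∀ {i j : I} {s t}, i ≤ j → LevelMem D (node j t) → c.r (node i s) (node j t) := by
    intro i j s t hij h
    exact c.trans (c.symm (con_of_bot_top c h (node_mem_Icc hij s)))
      (con_of_bot_top c h (node_mem_Icc le_rfl t))
  refine ⟨D, Setoid.ext fun a b => ⟨fun h => or_iff_not_imp_left.2 fun hne => ?_, ?_⟩⟩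
  · rcases a with _ | ⟨i, s⟩ <;> rcases b with _ | ⟨j, t⟩
    · exact absurd rfl hne
    · exact ⟨trivial, con_bot_top c (mem_Icc_core j) hne (c.symm h)⟩
    · exact ⟨con_bot_top c (mem_Icc_core i) (Ne.symm hne) h, trivial⟩
    · rcases le_total i j with hij | hij
      · exact key hij h hne
      · exact (key hij (c.symm h) (Ne.symm hne)).symm
  · rintro (rfl | ⟨ha, hb⟩)
    · exact c.refl a
    · rcases a with _ | ⟨i, s⟩ <;> rcases b with _ | ⟨j, t⟩
      · exact c.refl _
      · exact c.trans (c.symm (con_of_bot_top c hb (mem_Icc_core j)))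
          (con_of_bot_top c hb (node_mem_Icc le_rfl t))
      · exact c.trans (c.symm (con_of_bot_top c ha (node_mem_Icc le_rfl s)))
          (con_of_bot_top c ha (mem_Icc_core i))
      · rcases le_total i j with hij | hij
        · exact key' hij hb
        · exact c.symm (key' hij ha)

/-- An ideal with no greatest element is determined by the levels whose bottom or top it contains
and by whether it contains the core. -/
theorem ideal_ext_of_not_principal {J J' : Order.Ideal (NestedM3 I)}
    (hJ : J ∉ Set.range Order.Ideal.principal) (hJ' : J' ∉ Set.range Order.Ideal.principal)
    (hc : core ∈ J ↔ core ∈ J') (hb : ∀ i, node i ⊥ ∈ J ↔ node i ⊥ ∈ J')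
    (ht : ∀ i, node i ⊤ ∈ J ↔ node i ⊤ ∈ J') : J = J' := by
  have key : ∀ {J : Order.Ideal (NestedM3 I)}, J ∉ Set.range Order.Ideal.principal →
      ∀ i t, t ≠ ⊥ → (node i t ∈ J ↔ node i ⊤ ∈ J) := by
    intro J hJ i t ht
    refine ⟨fun h => ?_, J.lower (node_mem_Icc le_rfl t).2⟩
    -- If an ideal contains a non-bottom element of level `i` but not the top of that level, this
    -- element is its greatest: joins with it can neither climb to a higher level nor grow within
    -- level `i`.
    by_contra hi
    refine hJ ⟨node i t, le_antisymm (Order.Ideal.principal_le_iff.2 h) fun w hw => ?_⟩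
    have hw' := Order.Ideal.sup_mem h hw
    rw [Order.Ideal.mem_principal, ← sup_eq_left]
    have hs : ∀ s, node i s ∈ J → t ≤ s → s = t := by
      have : ∀ s t : Bool × Bool, t ≠ ⊥ → t ≤ s → s = t ∨ s = ⊤ := by decide
      intro s hs hts
      rcases this s t ht hts with h | rfl
      · exact h
      · exact absurd hs hi
    have hle : node i t ≤ node i t ⊔ w := le_sup_left
    generalize node i t ⊔ w = z at hw' hle
    rcases z with _ | ⟨k, s⟩
    · exact absurd hle ht
    · rcases hle with ⟨hk, rfl⟩ | ⟨hk, h⟩ | ⟨rfl, h⟩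
      · exact absurd (J.lower (node_mem_Icc hk.le ⊤).2 hw') hi
      · exact absurd h ht
      · rw [hs s hw' h]
  ext a
  rcases a with _ | ⟨i, t⟩
  · exact hc
  · by_cases h : t = ⊥
    · subst h; exact hb i
    · exact (key hJ i t h).trans ((ht i).trans (key hJ' i t h).symm)

end NestedM3

/-! ### The ordinal sum as an antiortholattice. -/

/-- The ordinal sum of a lattice `L`, a lattice `K` and the dual of `L`. -/
inductive Sandwich (L K : Type u) : Type u
  | low (a : L) : Sandwich L K
  | mid (k : K) : Sandwich L K
  | high (a : L) : Sandwich L K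

namespace Sandwich

open BoundedInvolutionLattice BZLattice

variable {L K : Type u}

section Lattice

variable [Lattice L] [Lattice K]

instance : PartialOrder (Sandwich L K) where
  le x y := match x, y with
    | low a, low b => a ≤ b
    | low _, mid _ => True
    | low _, high _ => True
    | mid _, low _ => False
    | mid k, mid l => k ≤ l
    | mid _, high _ => True
    | high _, low _ => False
    | high _, mid _ => False
    | high a, high b => b ≤ a
  le_refl x := by cases x <;> exact le_rfl
  le_trans x y z h h' := by
    cases x <;> cases y <;> cases z <;>
      first | trivial | exact False.elim h | exact False.elim h' | exact le_trans h h' |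
        exact le_trans h' h
  le_antisymm x y h h' := by
    cases x <;> cases y <;>
      first | exact False.elim h | exact False.elim h' | exact congrArg _ (le_antisymm h h') |
        exact congrArg _ (le_antisymm h' h)

@[simp] theorem low_le_low {a b : L} : (low a : Sandwich L K) ≤ low b ↔ a ≤ b := Iff.rfl
@[simp] theorem low_le_mid {a : L} {k : K} : low a ≤ mid k := trivial
@[simp] theorem low_le_high {a b : L} : (low a : Sandwich L K) ≤ high b := trivial
@[simp] theorem not_mid_le_low {a : L} {k : K} : ¬ mid k ≤ low a := id
@[simp] theorem mid_le_mid {k l : K} : (mid k : Sandwich L K) ≤ mid l ↔ k ≤ l := Iff.rfl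
@[simp] theorem mid_le_high {a : L} {k : K} : mid k ≤ high a := trivial
@[simp] theorem not_high_le_low {a b : L} : ¬ (high a : Sandwich L K) ≤ low b := id
@[simp] theorem not_high_le_mid {a : L} {k : K} : ¬ high a ≤ mid k := id
@[simp] theorem high_le_high {a b : L} : (high a : Sandwich L K) ≤ high b ↔ b ≤ a := Iff.rfl

instance : Lattice (Sandwich L K) where
  sup x y := match x, y with
    | low a, low b => low (a ⊔ b)
    | low _, mid k => mid k
    | low _, high b => high b
    | mid k, low _ => mid k
    | mid k, mid l => mid (k ⊔ l)
    | mid _, high b => high b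
    | high a, low _ => high a
    | high a, mid _ => high a
    | high a, high b => high (a ⊓ b)
  inf x y := match x, y with
    | low a, low b => low (a ⊓ b)
    | low a, mid _ => low a
    | low a, high _ => low a
    | mid _, low b => low b
    | mid k, mid l => mid (k ⊓ l)
    | mid k, high _ => mid k
    | high _, low b => low b
    | high _, mid l => mid l
    | high a, high b => high (a ⊔ b)
  le_sup_left x y := by cases x <;> cases y <;> simp
  le_sup_right x y := by cases x <;> cases y <;> simp
  sup_le x y z := by cases x <;> cases y <;> cases z <;> simp +contextual
  inf_le_left x y := by cases x <;> cases y <;> simp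
  inf_le_right x y := by cases x <;> cases y <;> simp
  le_inf x y z := by cases x <;> cases y <;> cases z <;> simp +contextual

@[simp] theorem low_sup_low (a b : L) : (low a ⊔ low b : Sandwich L K) = low (a ⊔ b) := rfl
@[simp] theorem low_sup_mid (a : L) (k : K) : low a ⊔ mid k = mid k := rfl
@[simp] theorem low_sup_high (a b : L) : (low a ⊔ high b : Sandwich L K) = high b := rfl
@[simp] theorem mid_sup_low (a : L) (k : K) : mid k ⊔ low a = mid k := rfl
@[simp] theorem mid_sup_mid (k l : K) : (mid k ⊔ mid l : Sandwich L K) = mid (k ⊔ l) := rfl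
@[simp] theorem mid_sup_high (a : L) (k : K) : mid k ⊔ high a = high a := rfl
@[simp] theorem high_sup_low (a b : L) : (high a ⊔ low b : Sandwich L K) = high a := rfl
@[simp] theorem high_sup_mid (a : L) (k : K) : high a ⊔ mid k = high a := rfl
@[simp] theorem high_sup_high (a b : L) : (high a ⊔ high b : Sandwich L K) = high (a ⊓ b) := rfl
@[simp] theorem low_inf_low (a b : L) : (low a ⊓ low b : Sandwich L K) = low (a ⊓ b) := rfl
@[simp] theorem low_inf_mid (a : L) (k : K) : low a ⊓ mid k = low a := rfl
@[simp] theorem low_inf_high (a b : L) : (low a ⊓ high b : Sandwich L K) = low a := rfl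
@[simp] theorem mid_inf_low (a : L) (k : K) : mid k ⊓ low a = low a := rfl
@[simp] theorem mid_inf_mid (k l : K) : (mid k ⊓ mid l : Sandwich L K) = mid (k ⊓ l) := rfl
@[simp] theorem mid_inf_high (a : L) (k : K) : mid k ⊓ high a = mid k := rfl
@[simp] theorem high_inf_low (a b : L) : (high a ⊓ low b : Sandwich L K) = low b := rfl
@[simp] theorem high_inf_mid (a : L) (k : K) : high a ⊓ mid k = mid k := rfl
@[simp] theorem high_inf_high (a b : L) : (high a ⊓ high b : Sandwich L K) = high (a ⊔ b) := rfl

end Lattice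

variable [Lattice L] [OrderBot L] [KleeneLattice K]

instance : BoundedOrder (Sandwich L K) where
  bot := low ⊥
  top := high ⊥
  bot_le x := by cases x <;> simp
  le_top x := by cases x <;> simp

-- If x ≤ y, then x′ and y cannot both lie in the lower copy of `L`, so x′ ∧ y = 0 only if one of
-- them is 0. This gives paraorthomodularity; likewise a ∧ a′ = 0 only for a = 0 or a = 1.
open Classical in
noncomputable instance : Antiortholattice (Sandwich L K) where
  invol
    | low a => high a
    | mid k => mid (KleeneLattice.neg k)
    | high a => low a
  invol_antitone x y := by
    cases x <;> cases y <;> simp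
    exact KleeneLattice.neg_antitone _ _
  invol_invol x := by cases x <;> simp [KleeneLattice.neg_neg]
  kleene x y := by
    cases x <;> cases y <;> simp
    exact KleeneLattice.neg_kleene _ _
  brouwer x := if x = low ⊥ then high ⊥ else low ⊥
  brouwer_antitone x y h := by
    by_cases hx : x = low ⊥
    · by_cases hy : y = low ⊥ <;> simp [hx, hy]
    · have hy : y ≠ low ⊥ := by
        rintro rfl
        cases x <;> simp_all
      simp [hx, hy]
  inf_brouwer x := by
    by_cases hx : x = low ⊥
    · simp only [hx, if_true]; rfl
    · simp only [hx, if_false]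
      cases x <;> simp <;> rfl
  le_brouwer_brouwer x := by
    by_cases hx : x = low ⊥
    · simp [hx]
    · simp only [hx, if_false, if_true]
      cases x <;> simp
  brouwer_brouwer x := by
    by_cases hx : x = low ⊥ <;> simp [hx]
  paraorthomodular x y h h' := by
    change _ = low ⊥ at h'
    cases x <;> cases y <;> simp_all
  brouwer_inf_invol x := by
    cases x <;> simp <;> split_ifs <;> simp
  isCompl_invol_iff x := by
    change _ ↔ x = low ⊥ ∨ x = high ⊥
    rw [isCompl_iff, disjoint_iff, codisjoint_iff]
    change _ = low ⊥ ∧ _ = high ⊥ ↔ _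
    cases x <;> simp

theorem brouwer_bot : brouwer (⊥ : Sandwich L K) = ⊤ := if_pos rfl
theorem brouwer_of_ne_bot {x : Sandwich L K} (h : x ≠ ⊥) : brouwer x = ⊥ := if_neg h

end Sandwich

/-! ### Congruences of the ordinal sum, and its filter-ideal duality. -/

namespace Sandwich

open BoundedInvolutionLattice BZLattice

variable {L K : Type u}

/-- The congruence of `Sandwich L K` that restricts to the given congruences on the summands. -/
def con [Lattice L] [Lattice K] (c : LatticeCon L) (d : LatticeCon K) :
    LatticeCon (Sandwich L K) where
  r x y := match x, y with
    | low a, low b => c.r a b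
    | mid k, mid l => d.r k l
    | high a, high b => c.r a b
    | _, _ => False
  iseqv := ⟨fun x => by cases x <;> first | exact c.refl _ | exact d.refl _,
    fun {x y} h => by
      cases x <;> cases y <;> first | exact False.elim h | exact c.symm h | exact d.symm h,
    fun {x y z} h h' => by
      cases x <;> cases y <;> cases z <;>
        first | exact False.elim h | exact False.elim h' | exact c.trans h h' |
          exact d.trans h h'⟩
  inf {w x y z} h h' := by
    cases w <;> cases x <;> cases y <;> cases z <;>
      first | exact False.elim h | exact False.elim h' | exact c.inf h h' | exact d.inf h h' |
        exact c.sup h h' | exact h | exact h'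
  sup {w x y z} h h' := by
    cases w <;> cases x <;> cases y <;> cases z <;>
      first | exact False.elim h | exact False.elim h' | exact c.inf h h' | exact d.sup h h' |
        exact c.sup h h' | exact h | exact h'

theorem con_injective_left [Lattice L] [Lattice K] {c c' : LatticeCon L} {d d' : LatticeCon K}
    (h : (con c d).toSetoid = (con c' d').toSetoid) : c.toSetoid = c'.toSetoid :=
  Setoid.ext fun a b => iff_of_eq (congrArg (fun θ : Setoid (Sandwich L K) => θ (low a) (low b)) h)

theorem con_injective_right [Lattice L] [Lattice K] {c c' : LatticeCon L} {d d' : LatticeCon K}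
    (h : (con c d).toSetoid = (con c' d').toSetoid) : d.toSetoid = d'.toSetoid :=
  Setoid.ext fun a b => iff_of_eq (congrArg (fun θ : Setoid (Sandwich L K) => θ (mid a) (mid b)) h)

variable [Lattice L] [OrderBot L] [KleeneLattice K]

theorem con_mem_latticeCongruences01 {c : LatticeCon L} (hc : ∀ a, c.r a ⊥ → a = ⊥)
    (d : LatticeCon K) : (con c d).toSetoid ∈ latticeCongruences01 (Sandwich L K) := by
  refine ⟨⟨_, rfl⟩, Set.eq_singleton_iff_unique_mem.2 ⟨c.refl ⊥, fun x hx => ?_⟩,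
    Set.eq_singleton_iff_unique_mem.2 ⟨c.refl ⊥, fun x hx => ?_⟩⟩
  · cases x
    · exact congrArg low (hc _ hx)
    · exact False.elim hx
    · exact False.elim hx
  · cases x
    · exact False.elim hx
    · exact False.elim hx
    · exact congrArg high (hc _ hx)

theorem eq_of_con_bot {θ : Setoid (Sandwich L K)} (hθ : θ ∈ latticeCongruences01 (Sandwich L K))
    {x : Sandwich L K} (h : θ x ⊥) : x = ⊥ := by
  have : x ∈ {x | θ x ⊥} := h
  rwa [hθ.2.1] at this

theorem eq_of_con_top {θ : Setoid (Sandwich L K)} (hθ : θ ∈ latticeCongruences01 (Sandwich L K))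
    {x : Sandwich L K} (h : θ x ⊤) : x = ⊤ := by
  have : x ∈ {x | θ x ⊤} := h
  rwa [hθ.2.2] at this

/-- The involution respects the congruence since both copies of `L` carry the same `c`; the Brouwer
complement only distinguishes 0 from the rest, and 0 is isolated. -/
theorem con_mem_bzCongruences {c : LatticeCon L} (hc : ∀ a, c.r a ⊥ → a = ⊥) {d : LatticeCon K}
    (hd : ∀ k l, d.r k l → d.r (KleeneLattice.neg k) (KleeneLattice.neg l)) :
    (con c d).toSetoid ∈ bzCongruences (Sandwich L K) := by
  refine ⟨⟨_, rfl⟩, fun x y h => ?_, fun x y h => ?_⟩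
  · cases x <;> cases y <;> first | exact False.elim h | exact h | exact hd _ _ h
  · have h01 := con_mem_latticeCongruences01 hc d
    by_cases hx : x = ⊥
    · subst hx
      rw [eq_of_con_bot h01 ((con c d).symm h)]
    · by_cases hy : y = ⊥
      · subst hy
        exact absurd (eq_of_con_bot h01 h) hx
      · rw [brouwer_of_ne_bot hx, brouwer_of_ne_bot hy]

theorem top_mem_bzCongruences : (⊤ : Setoid (Sandwich L K)) ∈ bzCongruences (Sandwich L K) :=
  ⟨⟨{ toSetoid := ⊤, inf := fun _ _ => trivial, sup := fun _ _ => trivial }, rfl⟩,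
    fun _ _ _ => trivial, fun _ _ _ => trivial⟩

theorem eq_top_of_bot_rel_top {θ : Setoid (Sandwich L K)}
    (hθ : θ ∈ latticeCongruences (Sandwich L K)) (h : θ ⊥ ⊤) : θ = ⊤ := by
  obtain ⟨c, rfl⟩ := hθ
  have key : ∀ x, c.r ⊥ x := fun x => by simpa using c.inf h (c.refl x)
  exact Setoid.ext fun x y => ⟨fun _ => trivial, fun _ => c.trans (c.symm (key x)) (key y)⟩

theorem mem_latticeCongruences01_or_eq_top {θ : Setoid (Sandwich L K)}
    (hθ : θ ∈ bzCongruences (Sandwich L K)) :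
    θ ∈ latticeCongruences01 (Sandwich L K) ∨ θ = ⊤ := by
  obtain ⟨hl, hi, hb⟩ := hθ
  refine or_iff_not_imp_right.2 fun htop => ?_
  have h0 : ∀ x, θ x ⊥ → x = ⊥ := by
    intro x hx
    by_contra hne
    have := hb _ _ hx
    rw [brouwer_of_ne_bot hne, brouwer_bot] at this
    exact htop (eq_top_of_bot_rel_top hl this)
  refine ⟨hl, Set.eq_singleton_iff_unique_mem.2 ⟨θ.refl _, h0⟩,
    Set.eq_singleton_iff_unique_mem.2 ⟨θ.refl _, fun x hx => ?_⟩⟩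
  have := h0 _ (hi _ _ hx)
  cases x
  · cases this
  · cases this
  · cases this; rfl

/-- If every element of `L` fails to lie above some element, and every failure of `b ≤ a` is
witnessed by a nonzero `c ≤ b` disjoint from `a`, then every congruence of `Sandwich L K` with
singleton classes of `0` and `1` is supported on `K`. -/
theorem exists_eq_con (hssc : ∀ a b : L, ¬ b ≤ a → ∃ c ≤ b, c ≠ ⊥ ∧ a ⊓ c = ⊥)
    (hmax : ∀ a : L, ∃ b, ¬ b ≤ a) {θ : Setoid (Sandwich L K)}
    (hθ : θ ∈ latticeCongruences01 (Sandwich L K)) :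
    ∃ d : LatticeCon K, θ = (con (LatticeCon.ker (LatticeHom.id L)) d).toSetoid := by
  have h0 : ∀ x, θ x ⊥ → x = ⊥ := fun _ => eq_of_con_bot hθ
  have h1 : ∀ x, θ x ⊤ → x = ⊤ := fun _ => eq_of_con_top hθ
  obtain ⟨⟨t, rfl⟩, -, -⟩ := hθ
  -- Meeting both sides with `low c` would identify a nonzero element with 0; `high_rel` is the dual
  -- argument at 1.
  have low_rel : ∀ a (x : Sandwich L K), (∃ c : L, c ≠ ⊥ ∧ low c ≤ x ∧ a ⊓ c = ⊥) →
      ¬ t.r (low a) x := by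
    rintro a x ⟨c, hc, hcx, hac⟩ h
    have := t.inf h (t.refl (low c))
    rw [low_inf_low, hac, inf_eq_right.2 hcx] at this
    exact hc (low.inj (h0 _ (t.symm this)))
  have high_rel : ∀ a (x : Sandwich L K), (∃ c : L, c ≠ ⊥ ∧ x ≤ high c ∧ a ⊓ c = ⊥) →
      ¬ t.r (high a) x := by
    rintro a x ⟨c, hc, hcx, hac⟩ h
    have := t.sup h (t.refl (high c))
    rw [high_sup_high, hac, sup_eq_right.2 hcx] at this
    exact hc (high.inj (h1 _ (t.symm this)))
  -- This element separates `low a` and `high a` from the other summands.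
  have hex : ∀ a : L, ∃ c, c ≠ ⊥ ∧ a ⊓ c = ⊥ := fun a => by
    obtain ⟨b, hb⟩ := hmax a
    obtain ⟨c, -, h⟩ := hssc a b hb
    exact ⟨c, h⟩
  have low_le : ∀ a b, t.r (low a) (low b) → b ≤ a := fun a b h => by
    by_contra hba
    obtain ⟨c, hcb, hc, hac⟩ := hssc a b hba
    exact low_rel a _ ⟨c, hc, hcb, hac⟩ h
  have high_le : ∀ a b, t.r (high a) (high b) → b ≤ a := fun a b h => by
    by_contra hba
    obtain ⟨c, hcb, hc, hac⟩ := hssc a b hba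
    exact high_rel a _ ⟨c, hc, hcb, hac⟩ h
  have low_mid : ∀ a k, ¬ t.r (low a) (mid k) := fun a k => by
    obtain ⟨c, hc, hac⟩ := hex a
    exact low_rel a _ ⟨c, hc, low_le_mid, hac⟩
  have low_high : ∀ a b, ¬ t.r (low a) (high b) := fun a b => by
    obtain ⟨c, hc, hac⟩ := hex a
    exact low_rel a _ ⟨c, hc, low_le_high, hac⟩
  have high_mid : ∀ a k, ¬ t.r (high a) (mid k) := fun a k => by
    obtain ⟨c, hc, hac⟩ := hex a
    exact high_rel a _ ⟨c, hc, mid_le_high, hac⟩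
  refine ⟨⟨⟨fun k l => t.r (mid k) (mid l), fun _ => t.refl _, t.symm, t.trans⟩,
    fun h h' => t.inf h h', fun h h' => t.sup h h'⟩, Setoid.ext fun x y => ?_⟩
  rcases x with a | a | a <;> rcases y with b | b | b
  · exact ⟨fun h => le_antisymm (low_le _ _ (t.symm h)) (low_le _ _ h), fun h => by
      cases (show a = b from h); exact t.refl _⟩
  · exact ⟨low_mid _ _, False.elim⟩
  · exact ⟨low_high _ _, False.elim⟩
  · exact ⟨fun h => low_mid _ _ (t.symm h), False.elim⟩
  · exact Iff.rfl
  · exact ⟨fun h => high_mid _ _ (t.symm h), False.elim⟩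
  · exact ⟨fun h => low_high _ _ (t.symm h), False.elim⟩
  · exact ⟨high_mid _ _, False.elim⟩
  · exact ⟨fun h => le_antisymm (high_le _ _ (t.symm h)) (high_le _ _ h), fun h => by
      cases (show a = b from h); exact t.refl _⟩

theorem bzCongruences_eq_union (hssc : ∀ a b : L, ¬ b ≤ a → ∃ c ≤ b, c ≠ ⊥ ∧ a ⊓ c = ⊥)
    (hmax : ∀ a : L, ∃ b, ¬ b ≤ a)
    (hK : ∀ (d : LatticeCon K) k l, d.r k l → d.r (KleeneLattice.neg k) (KleeneLattice.neg l)) :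
    bzCongruences (Sandwich L K) = latticeCongruences01 (Sandwich L K) ∪ {⊤} := by
  ext θ
  refine ⟨mem_latticeCongruences01_or_eq_top, ?_⟩
  rintro (h | rfl)
  · obtain ⟨d, rfl⟩ := exists_eq_con hssc hmax h
    exact con_mem_bzCongruences (fun _ h => h) (hK d)
  · exact top_mem_bzCongruences

theorem mk_bzCongruences (hssc : ∀ a b : L, ¬ b ≤ a → ∃ c ≤ b, c ≠ ⊥ ∧ a ⊓ c = ⊥)
    (hmax : ∀ a : L, ∃ b, ¬ b ≤ a)
    (hK : ∀ (d : LatticeCon K) k l, d.r k l → d.r (KleeneLattice.neg k) (KleeneLattice.neg l)) :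
    #(bzCongruences (Sandwich L K)) = #(latticeCongruences K) + 1 := by
  have hnot : (⊤ : Setoid (Sandwich L K)) ∉ latticeCongruences01 (Sandwich L K) := fun h => by
    have : (⊤ : Sandwich L K) = ⊥ := eq_of_con_bot h trivial
    cases this
  -- The extra 1 counts the total congruence, which does not isolate 0.
  rw [bzCongruences_eq_union hssc hmax hK, Set.union_singleton, mk_insert hnot]
  congr 1
  refine (mk_congr (Equiv.ofBijective (fun d : latticeCongruences K =>
    (⟨_, con_mem_latticeCongruences01 (c := LatticeCon.ker (LatticeHom.id L)) (fun _ h => h)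
      d.2.choose⟩ : latticeCongruences01 (Sandwich L K))) ⟨fun d d' h => ?_, ?_⟩)).symm
  · have := con_injective_right (Subtype.ext_iff.1 h)
    rw [d.2.choose_spec, d'.2.choose_spec] at this
    exact Subtype.ext this
  · rintro ⟨θ, hθ⟩
    obtain ⟨d, rfl⟩ := exists_eq_con hssc hmax hθ
    refine ⟨⟨d.toSetoid, d, rfl⟩, Subtype.ext ?_⟩
    have hs := (⟨d, rfl⟩ : d.toSetoid ∈ latticeCongruences K).choose_spec
    refine Setoid.ext fun x y => ?_
    rcases x with a | a | a <;> rcases y with b | b | b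
    all_goals try exact Iff.rfl
    exact iff_of_eq (congrArg (fun θ : Setoid K => θ a b) hs)

/-- The Kleene complement exchanges filters and ideals. -/
theorem mk_pFilter : #(Order.PFilter (Sandwich L K)) = #(Order.Ideal (Sandwich L K)) := by
  have anti : ∀ {x y : Sandwich L K}, x ≤ y → invol y ≤ invol x := invol_antitone _ _
  have inv : ∀ x : Sandwich L K, invol (invol x) = x := invol_invol
  refine le_antisymm ?_ ?_
  · refine mk_le_of_injective (f := fun F => (⟨⟨{x | invol x ∈ F}, fun x y h hx =>
      F.mem_of_le (anti h) hx⟩, ?_, ?_⟩ : Order.Ideal (Sandwich L K))) ?_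
    · obtain ⟨x, hx⟩ := F.nonempty
      exact ⟨invol x, by simpa [inv] using hx⟩
    · exact fun x hx y hy => ⟨x ⊔ y, by
        obtain ⟨z, hz, hzx, hzy⟩ := F.directed _ hx _ hy
        have hx' : invol (invol x) ≤ invol z := anti hzx
        have hy' : invol (invol y) ≤ invol z := anti hzy
        rw [inv] at hx' hy'
        have := anti (sup_le hx' hy')
        rw [inv] at this
        exact F.mem_of_le this hz, le_sup_left, le_sup_right⟩
    · intro F G h
      ext x
      have : invol x ∈ (_ : Order.Ideal _) ↔ invol x ∈ (_ : Order.Ideal _) :=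
        iff_of_eq (congrArg (fun J => invol x ∈ J) h)
      change invol (invol x) ∈ F ↔ invol (invol x) ∈ G at this
      rwa [inv] at this
  · refine mk_le_of_injective (f := fun J => (Order.IsPFilter.toPFilter (F := {x | invol x ∈ J})
      (.of_def ?_ ?_ fun h hx => J.lower (anti h) hx) : Order.PFilter (Sandwich L K))) ?_
    · obtain ⟨x, hx⟩ := J.nonempty
      exact ⟨invol x, by simpa [inv] using hx⟩
    · exact fun x hx y hy => ⟨x ⊓ y, by
        obtain ⟨z, hz, hzx, hzy⟩ := J.directed _ hx _ hy
        have hx' : invol z ≤ invol (invol x) := anti hzx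
        have hy' : invol z ≤ invol (invol y) := anti hzy
        rw [inv] at hx' hy'
        have := anti (le_inf hx' hy')
        rw [inv] at this
        exact J.lower this hz, inf_le_left, inf_le_right⟩
    · intro F G h
      ext x
      have : invol x ∈ (_ : Order.PFilter _) ↔ invol x ∈ (_ : Order.PFilter _) :=
        iff_of_eq (congrArg (fun J => invol x ∈ J) h)
      change invol (invol x) ∈ F ↔ invol (invol x) ∈ G at this
      rwa [inv] at this

end Sandwich

/-! ### Counting lower sets, ideals and filters. -/

/-- A proper lower set of a well-order is the initial segment below the least element it misses; the
extra 1 is the whole order. -/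
theorem mk_lowerSet_of_wellFoundedLT (I : Type u) [LinearOrder I] [WellFoundedLT I] :
    #(LowerSet I) = #I + 1 := by
  rw [← mk_option]
  refine (mk_congr (Equiv.ofBijective
    (fun o : Option I => o.elim ⊤ LowerSet.Iio) ⟨?_, fun D => ?_⟩)).symm
  · rintro (_ | a) (_ | b) h
    · rfl
    · have : b ∈ LowerSet.Iio b := (show ⊤ = LowerSet.Iio b from h) ▸ trivial
      exact absurd this (lt_irrefl b)
    · have : a ∈ LowerSet.Iio a := (show LowerSet.Iio a = ⊤ from h) ▸ trivial
      exact absurd this (lt_irrefl a)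
    · have h : LowerSet.Iio a = LowerSet.Iio b := h
      refine congrArg some (le_antisymm (le_of_not_gt fun hb => ?_) (le_of_not_gt fun hb => ?_))
      · have : b ∈ LowerSet.Iio b := h ▸ hb
        exact lt_irrefl b this
      · have : a ∈ LowerSet.Iio a := h.symm ▸ hb
        exact lt_irrefl a this
  · by_cases hD : ∀ a, a ∈ D
    · exact ⟨none, by ext a; exact iff_of_true trivial (hD a)⟩
    · have hne : {a | a ∉ D}.Nonempty := not_forall.1 hD
      obtain ⟨a, ha, hmin⟩ := WellFounded.has_min (r := (· < ·)) wellFounded_lt _ hne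
      refine ⟨some a, ?_⟩
      ext b
      exact ⟨fun hb => not_not.1 fun h => hmin b h hb,
        fun hb => lt_of_not_ge fun h => ha (D.lower h hb)⟩

theorem mk_upperSet_eq_mk_lowerSet (I : Type u) [LE I] : #(UpperSet I) = #(LowerSet I) :=
  mk_congr upperSetIsoLowerSet.toEquiv

theorem mk_le_mk_ideal (P : Type u) [PartialOrder P] : #P ≤ #(Order.Ideal P) :=
  mk_le_of_injective (f := Order.Ideal.principal) fun _ _ h =>
    le_antisymm (Order.Ideal.principal_le_iff.1 h.le) (Order.Ideal.principal_le_iff.1 h.ge)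

theorem mk_ideal_le_mk_set (P : Type u) [LE P] : #(Order.Ideal P) ≤ #(Set P) :=
  mk_le_of_injective (f := fun J => (J : Set P)) SetLike.coe_injective

theorem mk_ideal_le_mk_lowerSet (P : Type u) [LE P] : #(Order.Ideal P) ≤ #(LowerSet P) :=
  mk_le_of_injective Order.Ideal.toLowerSet_injective

theorem mk_pFilter_le_mk_upperSet (P : Type u) [Preorder P] :
    #(Order.PFilter P) ≤ #(UpperSet P) :=
  mk_le_of_injective (f := fun F => (⟨(F : Set P), fun _ _ h hx => F.mem_of_le h hx⟩ : UpperSet P))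
    fun _ _ h => SetLike.coe_injective (congrArg UpperSet.carrier h)

/-- A join-preserving map to a powerset whose range contains the singletons yields a distinct ideal
for every subset. -/
theorem two_power_le_mk_ideal {α L : Type u} [Lattice L] [OrderBot L] (f : L → Set α)
    (hbot : f ⊥ = ∅) (hsup : ∀ a b, f (a ⊔ b) = f a ∪ f b) (hsingle : ∀ x, ∃ a, f a = {x}) :
    2 ^ #α ≤ #(Order.Ideal L) := by
  rw [← mk_set]
  have hmono : Monotone f := fun a b h => by
    rw [← sup_eq_right.2 h, hsup]
    exact Set.subset_union_left
  refine mk_le_of_injective (f := fun S => (⟨⟨{a | f a ⊆ S}, fun _ _ h ha => (hmono h).trans ha⟩,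
    ⟨⊥, by simp [hbot]⟩, fun a ha b hb => ⟨a ⊔ b, by
      rw [Set.mem_ofPred_eq, hsup]
      exact Set.union_subset ha hb, le_sup_left, le_sup_right⟩⟩ : Order.Ideal L)) ?_
  have key : ∀ S T : Set α, {a | f a ⊆ S} = {a | f a ⊆ T} → S ⊆ T := by
    intro S T h x hx
    obtain ⟨a, ha⟩ := hsingle x
    have : a ∈ {a | f a ⊆ T} := h ▸ (by simpa [ha] using hx)
    simpa [ha] using this
  intro S T h
  have h' : {a | f a ⊆ S} = {a | f a ⊆ T} := congrArg (fun J : Order.Ideal L => (J : Set L)) h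
  exact (key S T h').antisymm (key T S h'.symm)

/-! ### Cardinalities attached to the nested chain. -/

namespace NestedM3

variable {I : Type u} {ν : Cardinal.{u}}

theorem mk_le (hν : ℵ₀ ≤ ν) (hI : #I ≤ ν) : #(NestedM3 I) ≤ ν := by
  have h : #(NestedM3 I) ≤ #(Option (I × ULift.{u} (Bool × Bool))) :=
    mk_le_of_injective (f := fun
      | core => none
      | node i t => some (i, ⟨t⟩)) (by rintro (_ | _) (_ | _) h <;> simp_all)
  refine h.trans ?_
  rw [mk_option, mk_prod, lift_id, lift_id]
  refine add_le_of_le hν (mul_le_of_le hν hI ?_) (one_le_aleph0.trans hν)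
  exact (lt_aleph0_of_finite _).le.trans hν

theorem mk_ideal_le [LinearOrder I] [WellFoundedLT I] (hν : ℵ₀ ≤ ν) (hI : #I ≤ ν) :
    #(Order.Ideal (NestedM3 I)) ≤ ν := by
  have hlow : #(LowerSet I) ≤ ν := by
    rw [mk_lowerSet_of_wellFoundedLT]
    exact add_le_of_le hν hI (one_le_aleph0.trans hν)
  have hup : #(UpperSet I) ≤ ν := (mk_upperSet_eq_mk_lowerSet I).trans_le hlow
  rw [← mk_sum_compl (Set.range (Order.Ideal.principal (P := NestedM3 I)))]
  refine add_le_of_le hν (mk_range_le.trans (mk_le hν hI)) ?_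
  -- Level bottoms descend and level tops ascend with the level, so a non-principal ideal is encoded
  -- by an upper set, a lower set and one bit for the core.
  have : #(↥(Set.range (Order.Ideal.principal (P := NestedM3 I)))ᶜ) ≤
      #(ULift.{u} Prop × UpperSet I × LowerSet I) := by
    refine mk_le_of_injective (f := fun J => (⟨core ∈ J.1⟩,
      ⟨{i | node i ⊥ ∈ J.1}, fun i j hij h => J.1.lower (node_mem_Icc hij ⊥).1 h⟩,
      ⟨{i | node i ⊤ ∈ J.1}, fun i j hij h => J.1.lower (node_mem_Icc hij ⊤).2 h⟩)) ?_
    intro J J' h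
    exact Subtype.ext (ideal_ext_of_not_principal J.2 J'.2
      (iff_of_eq (congrArg (fun p => p.1.down) h))
      (fun i => iff_of_eq (congrArg (fun p => i ∈ p.2.1) h))
      (fun i => iff_of_eq (congrArg (fun p => i ∈ p.2.2) h)))
  refine this.trans ?_
  simp only [mk_prod, lift_id]
  exact mul_le_of_le hν ((lt_aleph0_of_finite _).le.trans hν) (mul_le_of_le hν hup hlow)

theorem mk_latticeCongruences [LinearOrder I] :
    #(latticeCongruences (NestedM3 I)) = #(LowerSet I) := by
  refine (mk_congr (Equiv.ofBijective (fun D : LowerSet I =>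
    (⟨_, levelCon D, rfl⟩ : latticeCongruences (NestedM3 I))) ⟨fun D E h => ?_, ?_⟩)).symm
  · exact levelCon_injective (Subtype.ext_iff.1 h)
  · rintro ⟨_, c, rfl⟩
    obtain ⟨D, hD⟩ := exists_eq_levelCon c
    exact ⟨D, Subtype.ext hD.symm⟩

theorem con_neg [LinearOrder I] (c : LatticeCon (NestedM3 I)) (a b : NestedM3 I) (h : c.r a b) :
    c.r (KleeneLattice.neg a) (KleeneLattice.neg b) := by
  obtain ⟨D, hD⟩ := exists_eq_levelCon c
  change c.toSetoid a b at h
  change c.toSetoid (neg a) (neg b)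
  rw [hD] at h ⊢
  exact levelSetoid_neg.2 h

end NestedM3

/-! ### Cardinality and ideals of the ordinal sum. -/

namespace Sandwich

variable {L K : Type u} {ν : Cardinal.{u}}

theorem mk_eq (L K : Type u) : #(Sandwich L K) = #L + (#K + #L) := by
  rw [add_def, add_def]
  exact mk_congr
    { toFun := fun
        | low a => .inl a
        | mid k => .inr (.inl k)
        | high a => .inr (.inr a)
      invFun := fun
        | .inl a => low a
        | .inr (.inl k) => mid k
        | .inr (.inr a) => high a
      left_inv := fun x => by cases x <;> rfl
      right_inv := fun x => by rcases x with _ | _ | _ <;> rfl }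

theorem mk_eq_of_le (hν : ℵ₀ ≤ ν) (hL : #L = ν) (hK : #K ≤ ν) : #(Sandwich L K) = ν := by
  rw [mk_eq, hL, add_eq_right hν hK, add_eq_self hν]

variable [Lattice L] [Lattice K]

/-- An ideal is determined by its trace on the highest summand it meets; on the dual of `L` that
trace is a filter of `L`. -/
theorem mk_ideal_le_add [Nonempty L] [Nonempty K] : #(Order.Ideal (Sandwich L K)) ≤
    #(Order.Ideal L) + (#(Order.Ideal K) + #(Order.PFilter L)) := by
  let G : Order.Ideal L ⊕ Order.Ideal K ⊕ Order.PFilter L → Set (Sandwich L K)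
    | .inl J => {x | match x with
      | low a => a ∈ J
      | _ => False}
    | .inr (.inl J) => {x | match x with
      | low _ => True
      | mid k => k ∈ J
      | high _ => False}
    | .inr (.inr F) => {x | match x with
      | low _ => True
      | mid _ => True
      | high a => a ∈ F}
  have hG : ∀ J : Order.Ideal (Sandwich L K), ∃ s, (J : Set (Sandwich L K)) = G s := by
    intro J
    by_cases h : ∃ a, high a ∈ J
    · obtain ⟨a, ha⟩ := h
      refine ⟨.inr (.inr (Order.IsPFilter.toPFilter (F := {b | high b ∈ J}) (.of_def ⟨a, ha⟩
        (fun b hb c hc => ⟨b ⊓ c, Order.Ideal.sup_mem hb hc, inf_le_left, inf_le_right⟩)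
        (fun h hb => J.lower (high_le_high.2 h) hb)))), ?_⟩
      ext x
      cases x
      · exact iff_of_true (J.lower low_le_high ha) trivial
      · exact iff_of_true (J.lower mid_le_high ha) trivial
      · exact Iff.rfl
    · by_cases h' : ∃ k, mid k ∈ J
      · obtain ⟨k, hk⟩ := h'
        refine ⟨.inr (.inl ⟨⟨{l | mid l ∈ J}, fun _ _ h hl => J.lower (mid_le_mid.2 h) hl⟩,
          ⟨k, hk⟩, fun b hb c hc =>
            ⟨b ⊔ c, Order.Ideal.sup_mem hb hc, le_sup_left, le_sup_right⟩⟩), ?_⟩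
        ext x
        cases x
        · exact iff_of_true (J.lower low_le_mid hk) trivial
        · exact Iff.rfl
        · exact iff_of_false (fun hx => h ⟨_, hx⟩) id
      · have hne : ∃ a, low a ∈ J := by
          obtain ⟨x, hx⟩ := J.nonempty
          rcases x with a | k | a
          exacts [⟨a, hx⟩, absurd ⟨k, hx⟩ h', absurd ⟨a, hx⟩ h]
        refine ⟨.inl ⟨⟨{l | low l ∈ J}, fun _ _ h hl => J.lower (low_le_low.2 h) hl⟩,
          hne, fun b hb c hc =>
            ⟨b ⊔ c, Order.Ideal.sup_mem hb hc, le_sup_left, le_sup_right⟩⟩, ?_⟩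
        ext x
        cases x
        · exact Iff.rfl
        · exact iff_of_false (fun hx => h' ⟨_, hx⟩) id
        · exact iff_of_false (fun hx => h ⟨_, hx⟩) id
  choose g hg using hG
  rw [add_def, add_def]
  exact mk_le_of_injective (f := g) fun J J' h =>
    SetLike.coe_injective ((hg J).trans (h ▸ (hg J').symm))

theorem mk_ideal_eq (hν : ℵ₀ ≤ ν) [Nonempty L] [Nonempty K] (hL : #L = ν) (hK : #K ≤ ν)
    (hLi : #(Order.Ideal L) ≤ ν) (hLf : #(Order.PFilter L) ≤ ν) (hKi : #(Order.Ideal K) ≤ ν) :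
    #(Order.Ideal (Sandwich L K)) = ν :=
  le_antisymm (mk_ideal_le_add.trans (add_le_of_le hν hLi (add_le_of_le hν hKi hLf)))
    ((mk_eq_of_le hν hL hK).symm.trans_le (mk_le_mk_ideal _))

theorem mk_ideal_eq_two_power (hν : ℵ₀ ≤ ν) (hL : #L = ν) (hK : #K ≤ ν)
    (hLi : 2 ^ ν ≤ #(Order.Ideal L)) : #(Order.Ideal (Sandwich L K)) = 2 ^ ν := by
  refine le_antisymm ((mk_ideal_le_mk_set _).trans ?_) (hLi.trans ?_)
  · rw [mk_set, mk_eq_of_le hν hL hK]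
  · refine mk_le_of_injective (f := fun J => (⟨⟨{x | ∃ a ∈ J, x = low a}, ?_⟩, ?_, ?_⟩ :
      Order.Ideal (Sandwich L K))) ?_
    · rintro _ y hy ⟨a, ha, rfl⟩
      rcases y with b | k | b
      · exact ⟨b, J.lower hy ha, rfl⟩
      · exact hy.elim
      · exact hy.elim
    · obtain ⟨a, ha⟩ := J.nonempty
      exact ⟨_, a, ha, rfl⟩
    · rintro _ ⟨a, ha, rfl⟩ _ ⟨b, hb, rfl⟩
      exact ⟨low (a ⊔ b), ⟨_, Order.Ideal.sup_mem ha hb, rfl⟩, le_sup_left, le_sup_right⟩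
    · intro J J' h
      ext a
      have : low a ∈ (_ : Order.Ideal _) ↔ low a ∈ (_ : Order.Ideal _) :=
        iff_of_eq (congrArg (fun J : Order.Ideal (Sandwich L K) => low a ∈ J) h)
      change (∃ b ∈ J, low a = low b) ↔ ∃ b ∈ J', low a = low b at this
      simpa using this

end Sandwich

/-! ### Ordinal sums with 2^ν congruences. -/

namespace Sandwich

variable {α M K : Type u} {ν : Cardinal.{u}}

/-- Intersecting a homomorphism to a powerset with a fixed set. -/
def traceHom [Lattice M] (f : LatticeHom M (Set α)) (S : Set α) : LatticeHom M (Set α) where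
  toFun m := f m ∩ S
  map_sup' a b := by rw [map_sup]; exact Set.union_inter_distrib_right _ _ _
  map_inf' a b := by rw [map_inf]; exact Set.inter_inter_distrib_right _ _ _

/-- Each subset `S` gives the kernel of intersecting with `S`, and the new bottom keeps 0 isolated.
A pair whose images differ by the single point x is identified exactly when x ∉ S, so `S` is
recovered. -/
theorem mk_bzCongruences_withBot [Lattice M] [KleeneLattice K] (hν : ℵ₀ ≤ ν)
    (hS : #(Sandwich (WithBot M) K) = ν) (hα : #α = ν) (f : LatticeHom M (Set α))
    (hf : ∀ x, ∃ a b, x ∉ f a ∧ f b = insert x (f a)) :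
    #(bzCongruences (Sandwich (WithBot M) K)) = 2 ^ ν := by
  refine le_antisymm ?_ ?_
  · have : #(bzCongruences (Sandwich (WithBot M) K)) ≤
        #(Set (Sandwich (WithBot M) K × Sandwich (WithBot M) K)) :=
      mk_le_of_injective (f := fun θ => {p | θ.1 p.1 p.2}) fun θ θ' h =>
        Subtype.ext (Setoid.ext fun x y => Set.ext_iff.1 h (x, y))
    rwa [mk_set, mk_prod, lift_id, hS, mul_eq_self hν] at this
  · rw [← hα, ← mk_set]
    have hbot : ∀ (S : Set α) (a : WithBot M),
        (LatticeCon.ker (traceHom f S).withBot).r a ⊥ → a = ⊥ := by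
      intro S a h
      cases a
      · rfl
      · cases h
    refine mk_le_of_injective (f := fun S => (⟨_, con_mem_bzCongruences (hbot S)
      (d := LatticeCon.ker (LatticeHom.id K)) fun _ _ h => congrArg KleeneLattice.neg h⟩ :
      bzCongruences (Sandwich (WithBot M) K))) ?_
    intro S T h
    have hc := con_injective_left (Subtype.ext_iff.1 h)
    have hmem : ∀ (S : Set α) {x a b}, x ∉ f a → f b = insert x (f a) →
        ((LatticeCon.ker (traceHom f S).withBot).toSetoid (a : WithBot M) (b : WithBot M) ↔
          x ∉ S) := by
      intro S x a b hx hb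
      change (((f a ∩ S : Set α) : WithBot (Set α)) = ((f b ∩ S : Set α) : WithBot (Set α))) ↔ _
      rw [WithBot.coe_inj, hb]
      constructor
      · intro h hxS
        exact hx (h.ge ⟨Set.mem_insert _ _, hxS⟩).1
      · intro hxS
        rw [Set.insert_inter_of_notMem hxS]
    ext x
    obtain ⟨a, b, hx, hb⟩ := hf x
    rw [← not_iff_not, ← hmem S hx hb, ← hmem T hx hb, hc]

end Sandwich

/-! ### The lattice of intervals of a linear order. -/

namespace Interval

variable {α : Type u} [LinearOrder α]

theorem exists_le_inf_eq_bot (a b : Interval α) (h : ¬ b ≤ a) : ∃ c ≤ b, c ≠ ⊥ ∧ a ⊓ c = ⊥ := by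
  have h' : ¬ (b : Set α) ⊆ a := fun hs => h (coe_subset_coe.1 hs)
  obtain ⟨x, hb, ha⟩ := Set.not_subset.1 h'
  refine ⟨pure x, ?_, pure_ne_bot, ?_⟩
  · rw [← coe_subset_coe, coe_pure]
    exact Set.singleton_subset_iff.2 hb
  · apply SetLike.coe_injective
    rw [coe_inf, coe_pure, coe_bot]
    exact Set.inter_singleton_eq_empty.2 ha

theorem exists_not_le [NoMaxOrder α] [Nonempty α] (a : Interval α) : ∃ b, ¬ b ≤ a := by
  have key : ∀ x : α, (∀ y ∈ a, y < x) → ∃ b, ¬ b ≤ a := fun x hx => by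
    refine ⟨pure x, fun h => ?_⟩
    have : x ∈ a := coe_subset_coe.2 h (mem_pure_self x)
    exact lt_irrefl x (hx x this)
  induction a using recBotCoe with
  | bot => exact ⟨pure (Classical.arbitrary α), fun h => pure_ne_bot (le_bot_iff.1 h)⟩
  | coe s =>
    obtain ⟨x, hx⟩ := exists_gt s.snd
    exact key x fun y hy => lt_of_le_of_lt hy.2 hx

theorem mk_eq {ν : Cardinal.{u}} (hν : ℵ₀ ≤ ν) (hα : #α = ν) : #(Interval α) = ν := by
  refine le_antisymm ?_ (hα ▸ mk_le_of_injective pure_injective)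
  have : #(Interval α) = #(NonemptyInterval α) + 1 := mk_option
  rw [this]
  refine add_le_of_le hν ?_ (one_le_aleph0.trans hν)
  have := mk_le_of_injective (NonemptyInterval.toProd_injective (α := α))
  rwa [mk_prod, lift_id, hα, mul_eq_self hν] at this

theorem coe_mem_ideal_iff (J : Order.Ideal (Interval α)) (s : NonemptyInterval α) :
    (s : Interval α) ∈ J ↔ pure s.fst ∈ J ∧ pure s.snd ∈ J := by
  refine ⟨fun h => ⟨J.lower ?_ h, J.lower ?_ h⟩, fun h => J.lower ?_ (Order.Ideal.sup_mem h.1 h.2)⟩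
  · exact coe_le_coe.2 ⟨le_rfl, s.fst_le_snd⟩
  · exact coe_le_coe.2 ⟨s.fst_le_snd, le_rfl⟩
  · exact coe_le_coe.2 ⟨inf_le_left, le_sup_right⟩

theorem ordConnected_pure_mem (J : Order.Ideal (Interval α)) :
    {x | pure x ∈ J}.OrdConnected := by
  refine ⟨fun x hx y hy z hz => J.lower ?_ (Order.Ideal.sup_mem hx hy)⟩
  exact coe_le_coe.2 ⟨inf_le_left.trans hz.1, hz.2.trans le_sup_right⟩

/-- An ideal is determined by the points it contains; they form an order-convex set, the
intersection of its upper and lower closures. -/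
theorem mk_ideal_le : #(Order.Ideal (Interval α)) ≤ #(UpperSet α) * #(LowerSet α) := by
  rw [← lift_id #(UpperSet α), ← lift_id #(LowerSet α), ← mk_prod]
  refine mk_le_of_injective (f := fun J => (upperClosure {x | pure x ∈ J},
    lowerClosure {x | pure x ∈ J})) fun J J' h => ?_
  have hs : {x : α | pure x ∈ J} = {x | pure x ∈ J'} := by
    rw [← (ordConnected_pure_mem J).upperClosure_inter_lowerClosure,
      ← (ordConnected_pure_mem J').upperClosure_inter_lowerClosure, (Prod.mk.inj h).1,
      (Prod.mk.inj h).2]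
  ext a
  induction a using recBotCoe with
  | bot => exact iff_of_true (Order.Ideal.bot_mem J) (Order.Ideal.bot_mem J')
  | coe s =>
    exact (coe_mem_ideal_iff J s).trans ((and_congr (Set.ext_iff.1 hs _)
      (Set.ext_iff.1 hs _)).trans (coe_mem_ideal_iff J' s).symm)

theorem coe_mem_pFilter_iff {F : Order.PFilter (Interval α)} (hF : ⊥ ∉ F)
    (s : NonemptyInterval α) : (s : Interval α) ∈ F ↔
      (∃ t : NonemptyInterval α, (t : Interval α) ∈ F ∧ s.fst ≤ t.fst) ∧
      ∃ t : NonemptyInterval α, (t : Interval α) ∈ F ∧ t.snd ≤ s.snd := by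
  refine ⟨fun h => ⟨⟨s, h, le_rfl⟩, s, h, le_rfl⟩, ?_⟩
  rintro ⟨⟨t, ht, hst⟩, r, hr, hrs⟩
  obtain ⟨w, hw, hwt, hwr⟩ := F.directed _ ht _ hr
  have hw0 : w ≠ ⊥ := fun h => hF (h ▸ hw)
  lift w to NonemptyInterval α using hw0
  have hwt : w ≤ t := coe_le_coe.1 hwt
  have hwr : w ≤ r := coe_le_coe.1 hwr
  exact F.mem_of_le (coe_le_coe.2 (⟨hst.trans hwt.1, hwr.2.trans hrs⟩ : w ≤ s)) hw

/-- The factor 2 records whether the filter is improper. A proper one is determined by the cuts its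
left and right endpoints generate, by directedness. -/
theorem mk_pFilter_le : #(Order.PFilter (Interval α)) ≤ 2 * (#(LowerSet α) * #(UpperSet α)) := by
  have h2 : (2 : Cardinal.{u}) = #(ULift.{u} Prop) := by simp
  rw [h2, ← lift_id #(UpperSet α), ← lift_id #(LowerSet α), ← mk_prod,
    ← lift_id #(ULift.{u} Prop), ← lift_id #(LowerSet α × UpperSet α), ← mk_prod]
  refine mk_le_of_injective (f := fun F => (⟨⊥ ∈ F⟩,
    ⟨{x | ∃ t : NonemptyInterval α, (t : Interval α) ∈ F ∧ x ≤ t.fst},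
      fun x y h ⟨t, ht, hx⟩ => ⟨t, ht, le_trans h hx⟩⟩,
    ⟨{x | ∃ t : NonemptyInterval α, (t : Interval α) ∈ F ∧ t.snd ≤ x},
      fun x y h ⟨t, ht, hx⟩ => ⟨t, ht, le_trans hx h⟩⟩)) fun F G h => ?_
  have h0 : ⊥ ∈ F ↔ ⊥ ∈ G := iff_of_eq (congrArg (fun p => p.1.down) h)
  have h1 : ∀ x, (∃ t : NonemptyInterval α, (t : Interval α) ∈ F ∧ x ≤ t.fst) ↔
      ∃ t : NonemptyInterval α, (t : Interval α) ∈ G ∧ x ≤ t.fst :=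
    fun x => iff_of_eq (congrArg (fun p => x ∈ p.2.1) h)
  have h3 : ∀ x, (∃ t : NonemptyInterval α, (t : Interval α) ∈ F ∧ t.snd ≤ x) ↔
      ∃ t : NonemptyInterval α, (t : Interval α) ∈ G ∧ t.snd ≤ x :=
    fun x => iff_of_eq (congrArg (fun p => x ∈ p.2.2) h)
  ext a
  by_cases hF : ⊥ ∈ F
  · exact iff_of_true (F.mem_of_le bot_le hF) (G.mem_of_le bot_le (h0.1 hF))
  · have hG : ⊥ ∉ G := fun hG => hF (h0.2 hG)
    induction a using recBotCoe with
    | bot => exact h0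
    | coe s =>
      exact (coe_mem_pFilter_iff hF s).trans
        ((and_congr (h1 _) (h3 _)).trans (coe_mem_pFilter_iff hG s).symm)

end Interval

theorem Finset.exists_le_inf_eq_bot {α : Type u} [DecidableEq α] (a b : Finset α) (h : ¬ b ≤ a) :
    ∃ c ≤ b, c ≠ ⊥ ∧ a ⊓ c = ⊥ := by
  obtain ⟨x, hb, ha⟩ := Finset.not_subset.1 h
  refine ⟨{x}, Finset.singleton_subset_iff.2 hb, Finset.singleton_ne_empty x, ?_⟩
  exact Finset.inter_singleton_of_notMem ha

/-! ### Choice of the summands. -/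

theorem exists_infinite_linearOrder {ν : Cardinal.{u}} (hν : ℵ₀ ≤ ν) :
    ∃ (α : Type u) (_ : LinearOrder α), WellFoundedLT α ∧ NoMaxOrder α ∧ Infinite α ∧ #α = ν :=
  ⟨ν.ord.ToType, inferInstance, inferInstance, noMaxOrder hν,
    infinite_iff.2 ((mk_ord_toType ν).symm ▸ hν), mk_ord_toType ν⟩

theorem exists_antiortholattice_of_le {ν κ μ : Cardinal.{u}} (hν : ℵ₀ ≤ ν) (h2 : 2 ≤ κ)
    (hκ : κ ≤ ν) (hμ : μ = ν ∨ μ = 2 ^ ν) :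
    ∃ (A : Type u) (_ : Antiortholattice A), #A = ν ∧ #(Order.Ideal A) = μ ∧
      #(Order.PFilter A) = μ ∧ #(bzCongruences A) = κ ∧
      bzCongruences A = latticeCongruences01 A ∪ {⊤} := by
  -- Of the 2 split off from κ, one is the full lower set of `I` and the other is the total
  -- congruence.
  obtain ⟨ι, hι⟩ := exists_add_of_le h2
  have hιν : ι ≤ ν := le_trans (by rw [hι]; exact self_le_add_left _ _) hκ
  let I := ι.ord.ToType
  have hI : #I = ι := mk_ord_toType ι
  have hIν : #I ≤ ν := hI.trans_le hιν
  have hK : #(latticeCongruences (NestedM3 I)) + 1 = κ := by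
    rw [NestedM3.mk_latticeCongruences, mk_lowerSet_of_wellFoundedLT, hI, hι, add_assoc,
      one_add_one_eq_two, add_comm]
  have : Nonempty (NestedM3 I) := ⟨.core⟩
  obtain ⟨α, _, _, _, _, hα⟩ := exists_infinite_linearOrder hν
  classical
  rcases hμ with rfl | rfl
  · have hlow : #(LowerSet α) ≤ μ := by
      rw [mk_lowerSet_of_wellFoundedLT, hα]
      exact add_le_of_le hν le_rfl (one_le_aleph0.trans hν)
    have hup : #(UpperSet α) ≤ μ := (mk_upperSet_eq_mk_lowerSet α).trans_le hlow
    have hL : #(Interval α) = μ := Interval.mk_eq hν hα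
    have hid : #(Order.Ideal (Sandwich (Interval α) (NestedM3 I))) = μ :=
      Sandwich.mk_ideal_eq hν hL (NestedM3.mk_le hν hIν)
        (Interval.mk_ideal_le.trans (mul_le_of_le hν hup hlow))
        (Interval.mk_pFilter_le.trans (mul_le_of_le hν
          ((natCast_lt_aleph0 (n := 2)).le.trans hν) (mul_le_of_le hν hlow hup)))
        (NestedM3.mk_ideal_le hν hIν)
    refine ⟨Sandwich (Interval α) (NestedM3 I), inferInstance,
      Sandwich.mk_eq_of_le hν hL (NestedM3.mk_le hν hIν), hid, Sandwich.mk_pFilter.trans hid, ?_, ?_⟩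
    · rw [Sandwich.mk_bzCongruences Interval.exists_le_inf_eq_bot Interval.exists_not_le
        NestedM3.con_neg, hK]
    · exact Sandwich.bzCongruences_eq_union Interval.exists_le_inf_eq_bot Interval.exists_not_le
        NestedM3.con_neg
  · have hL : #(Finset α) = ν := (mk_finset_of_infinite α).trans hα
    have hid : #(Order.Ideal (Sandwich (Finset α) (NestedM3 I))) = 2 ^ ν :=
      Sandwich.mk_ideal_eq_two_power hν hL (NestedM3.mk_le hν hIν)
        (hα ▸ two_power_le_mk_ideal (fun F : Finset α => (F : Set α)) Finset.coe_empty
          Finset.coe_union fun x => ⟨{x}, Finset.coe_singleton x⟩)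
    have hmax : ∀ a : Finset α, ∃ b, ¬ b ≤ a := fun a => by
      obtain ⟨x, hx⟩ := Infinite.exists_notMem_finset a
      exact ⟨{x}, fun h => hx (Finset.singleton_subset_iff.1 h)⟩
    refine ⟨Sandwich (Finset α) (NestedM3 I), inferInstance,
      Sandwich.mk_eq_of_le hν hL (NestedM3.mk_le hν hIν), hid, Sandwich.mk_pFilter.trans hid, ?_, ?_⟩
    · rw [Sandwich.mk_bzCongruences Finset.exists_le_inf_eq_bot hmax NestedM3.con_neg, hK]
    · exact Sandwich.bzCongruences_eq_union Finset.exists_le_inf_eq_bot hmax NestedM3.con_neg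

theorem exists_antiortholattice_two_power {ν μ : Cardinal.{u}} (hν : ℵ₀ ≤ ν)
    (hμ : μ = ν ∨ μ = 2 ^ ν) :
    ∃ (A : Type u) (_ : Antiortholattice A), #A = ν ∧ #(Order.Ideal A) = μ ∧
      #(Order.PFilter A) = μ ∧ #(bzCongruences A) = 2 ^ ν := by
  obtain ⟨α, _, _, _, _, hα⟩ := exists_infinite_linearOrder hν
  -- With no levels, the middle summand is just the core.
  let I := (0 : Ordinal.{u}).ToType
  have hI : #I ≤ ν := by simp [I]
  have hK := NestedM3.mk_le hν hI
  have : Nonempty (NestedM3 I) := ⟨.core⟩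
  classical
  have mk_withBot : ∀ M : Type u, #M = ν → #(WithBot M) = ν := fun M hM => by
    rw [show #(WithBot M) = #M + 1 from mk_option, hM, add_one_eq hν]
  rcases hμ with rfl | rfl
  · have hL := mk_withBot α hα
    have hlow : #(LowerSet (WithBot α)) ≤ μ := by
      rw [mk_lowerSet_of_wellFoundedLT, hL, add_one_eq hν]
    have hid : #(Order.Ideal (Sandwich (WithBot α) (NestedM3 I))) = μ :=
      Sandwich.mk_ideal_eq hν hL hK ((mk_ideal_le_mk_lowerSet _).trans hlow)
        ((mk_pFilter_le_mk_upperSet _).trans ((mk_upperSet_eq_mk_lowerSet _).trans_le hlow))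
        (NestedM3.mk_ideal_le hν hI)
    have hS := Sandwich.mk_eq_of_le hν hL hK
    refine ⟨Sandwich (WithBot α) (NestedM3 I), inferInstance, hS, hid,
      Sandwich.mk_pFilter.trans hid, ?_⟩
    -- Successors make the initial segments below x and below its successor differ by exactly x.
    let _ : SuccOrder α := SuccOrder.ofLinearWellFoundedLT α
    refine Sandwich.mk_bzCongruences_withBot hν hS hα (α := α)
      { toFun := Set.Iio
        map_sup' := fun a b => by ext; simp
        map_inf' := fun a b => by ext; simp } fun x => ⟨x, Order.succ x, ?_, ?_⟩
    · exact lt_irrefl x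
    · ext y
      change y < Order.succ x ↔ y = x ∨ y < x
      rw [Order.lt_succ_iff, le_iff_eq_or_lt]
  · have hL := mk_withBot (Finset α) ((mk_finset_of_infinite α).trans hα)
    have hid : #(Order.Ideal (Sandwich (WithBot (Finset α)) (NestedM3 I))) = 2 ^ ν := by
      refine Sandwich.mk_ideal_eq_two_power hν hL hK ?_
      rw [← hα]
      -- The new bottom and the empty set both map to ∅, which is harmless as only singletons must
      -- be attained.
      refine two_power_le_mk_ideal (fun a : WithBot (Finset α) => {x | ({x} : Finset α) ≤ a})
        ?_ ?_ fun x => ⟨(({x} : Finset α) : WithBot (Finset α)), ?_⟩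
      · ext x
        simp
      · intro a b
        ext x
        cases a <;> cases b <;> simp [← WithBot.coe_sup, WithBot.coe_le_coe]
      · ext y
        simp [WithBot.coe_le_coe]
    have hS := Sandwich.mk_eq_of_le hν hL hK
    refine ⟨Sandwich (WithBot (Finset α)) (NestedM3 I), inferInstance, hS, hid,
      Sandwich.mk_pFilter.trans hid, ?_⟩
    exact Sandwich.mk_bzCongruences_withBot hν hS hα (α := α)
      { toFun := fun F : Finset α => (F : Set α)
        map_sup' := Finset.coe_union
        map_inf' := Finset.coe_inter } fun x =>
          ⟨∅, {x}, by simp, by ext y; simp⟩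

theorem corollary4p10 (ν κ μ : Cardinal.{u}) (hν : ℵ₀ ≤ ν)
    (hκ : (2 ≤ κ ∧ κ ≤ ν) ∨ κ = 2 ^ ν) (hμ : μ = ν ∨ μ = 2 ^ ν) :
    ∃ (A : Type u) (_ : Antiortholattice A),
      #A = ν ∧
      #(Order.PFilter A) = μ ∧ #(Order.Ideal A) = μ ∧
      #(bzCongruences A) = κ ∧
      (κ ≤ ν → bzCongruences A = latticeCongruences01 A ∪ {⊤}) := by
  rcases hκ with ⟨h2, hκ⟩ | rfl
  · obtain ⟨A, hA, h, hi, hf, hc, h01⟩ := exists_antiortholattice_of_le hν h2 hκ hμ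
    exact ⟨A, hA, h, hf, hi, hc, fun _ => h01⟩
  · obtain ⟨A, hA, h, hi, hf, hc⟩ := exists_antiortholattice_two_power hν hμ
    exact ⟨A, hA, h, hf, hi, hc, fun hle => absurd hle (cantor ν).not_ge⟩
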